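/- Let $\mathcal A$ be a unital exact $C^*$-algebra, let $\theta:\mathcal A\to\mathcal A$ be a unital completely positive map, and let $a\in\mathcal A$ be self-adjoint. Let $\pi:\mathcal A\to B(\mathcal H)$ be a faithful unital $*$-representation on a Hilbert space. For a finite set $\Omega\subset\mathcal A$ and $n\ge 1$ put $$\Omega^{(n)}=\Omega\cup\theta(\Omega)\cup\dots\cup\theta^{n-1}(\Omega),\qquad a^{(n)}=\sum_{j=0}^{n-1}\theta^j(a).$$ For $S\subset\mathcal A$ and $\delta>0$ let $\mathrm{CPA}(\pi,S,\delta)$ be the collection of all triples $(\phi,\psi,\mathcal B)$ in which $\mathcal B$ is a finite-dimensional $C^*$-algebra and $\phi:\mathcal A\to\mathcal B$, $\psi:\mathcal B\to B(\mathcal H)$ are unital completely positive maps such that $\|\psi(\phi(x))-\pi(x)\|<\delta$ for all $x\in S$. Let $\mathrm{CPA}_0(\pi,S,\delta)$ be defined in the same way, but with $\phi$ and $\psi$ only required to be completely positive contractions (not necessarily unital). Define $$Z_{\theta,n}(\pi,a,\Omega,\delta)=\inf\{\mathrm{Tr}\,e^{\phi(a^{(n)})}:(\phi,\psi,\mathcal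 B)\in\mathrm{CPA}(\pi,\Omega^{(n)},\delta)\},$$ where $\mathrm{Tr}$ is the trace of $\mathcal B$ that takes the value $1$ on every minimal projection and $\inf\emptyset=+\infty$, and $$P_\theta(\pi,a)=\sup_{\Omega\subset\mathcal A\text{ finite}}\ \sup_{\delta>0}\ \limsup_{n\to\infty}\frac1n\log Z_{\theta,n}(\pi,a,\Omega,\delta)\in[-\infty,+\infty].$$ Let $Z^0_{\theta,n}(\pi,a,\Omega,\delta)$ and $P^0_\theta(\pi,a)$ be defined by the same formulas with $\mathrm{CPA}_0$ in place of $\mathrm{CPA}$. Then $$P^0_\theta(\pi,a)=P_\theta(\pi,a).$$ -/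

import Mathlib

open scoped TensorProduct ENNReal CStarAlgebra

noncomputable section

namespace NCPressure

universe u v

section Exactness

variable {A : Type*} {B : Type*} [NonUnitalCStarAlgebra A] [NonUnitalCStarAlgebra B]
variable {H : Type*} {K : Type*}
  [NormedAddCommGroup H] [InnerProductSpace ℂ H] [NormedAddCommGroup K] [InnerProductSpace ℂ K]
  [CompleteSpace H] [CompleteSpace K]

/-- The representation `π ⊗ σ` of the algebraic tensor product `A ⊗ B` by bounded operators on the
(algebraic) tensor product of the two Hilbert spaces, `a ⊗ b ↦ π a ⊗ σ b`.  A bounded operator on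
the algebraic tensor product of Hilbert spaces has the same norm as its extension to the completion.
Thus, for faithful `π` and `σ`, `t ↦ ‖tensorRep π σ t‖` is the minimal (spatial) `C⋆`-norm. -/
def tensorRep (π : A →⋆ₙₐ[ℂ] (H →L[ℂ] H)) (σ : B →⋆ₙₐ[ℂ] (K →L[ℂ] K)) :
    (A ⊗[ℂ] B) →ₗ[ℂ] ((H ⊗[ℂ] K) →L[ℂ] (H ⊗[ℂ] K)) :=
  TensorProduct.lift
    (LinearMap.mk₂ ℂ (fun (a : A) (b : B) => TensorProduct.mapL (π a) (σ b))
      (fun a a' b => by rw [map_add, TensorProduct.mapL_add_left])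
      (fun c a b => by rw [map_smul, TensorProduct.mapL_smul_left])
      (fun a b b' => by rw [map_add, TensorProduct.mapL_add_right])
      (fun c a b => by rw [map_smul, TensorProduct.mapL_smul_right]))

end Exactness

/-- A `C⋆`-algebra `A` is exact if minimal tensor products with `A` preserve short exact sequences:
for every surjective `⋆`-homomorphism `q : B → C` of `C⋆`-algebras, the sequence
`0 → A ⊗ ker q → A ⊗ B → A ⊗ C → 0` of minimal tensor products is exact.

Exactness at the two ends is automatic, and exactness in the middle says that an element of the
completion `A ⊗ B` (the limit of a Cauchy sequence `x` of the algebraic tensor product for the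
minimal norm) that is mapped to `0` in `A ⊗ C` lies in the closure of the algebraic tensor product
of `A` and `ker q`.  The minimal norms are computed in faithful representations
(and do not depend on them). -/
def IsExact (A : Type u) [NonUnitalCStarAlgebra A] : Prop :=
  ∀ (B C : Type u) [NonUnitalCStarAlgebra B] [NonUnitalCStarAlgebra C] (q : B →⋆ₙₐ[ℂ] C),
    Function.Surjective q →
  ∀ (H K L : Type u)
    [NormedAddCommGroup H] [InnerProductSpace ℂ H] [CompleteSpace H]
    [NormedAddCommGroup K] [InnerProductSpace ℂ K] [CompleteSpace K]
    [NormedAddCommGroup L] [InnerProductSpace ℂ L] [CompleteSpace L]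
    (π : A →⋆ₙₐ[ℂ] (H →L[ℂ] H)) (σ : B →⋆ₙₐ[ℂ] (K →L[ℂ] K)) (ρ : C →⋆ₙₐ[ℂ] (L →L[ℂ] L)),
    Function.Injective π → Function.Injective σ → Function.Injective ρ →
  ∀ x : ℕ → A ⊗[ℂ] B,
    CauchySeq (fun n => tensorRep π σ (x n)) →
    Filter.Tendsto (fun n => tensorRep π ρ (LinearMap.lTensor A (q : B →ₗ[ℂ] C) (x n)))
      Filter.atTop (nhds 0) →
    ∃ y : ℕ → A ⊗[ℂ] (LinearMap.ker (q : B →ₗ[ℂ] C)),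
      Filter.Tendsto
        (fun n => tensorRep π σ
          (x n - LinearMap.lTensor A (LinearMap.ker (q : B →ₗ[ℂ] C)).subtype (y n)))
        Filter.atTop (nhds 0)

/-- The finite-dimensional `C⋆`-algebra `M_{d 0}(ℂ) ⊕ ⋯ ⊕ M_{d (k-1)}(ℂ)`, where `M_m(ℂ)` is the
algebra of operators on the Hilbert space `ℂ^m`.  Up to isomorphism every finite-dimensional
`C⋆`-algebra has this form. -/
abbrev FinDimAlg {k : ℕ} (d : Fin k → ℕ) : Type :=
  ∀ i : Fin k, EuclideanSpace ℂ (Fin (d i)) →L[ℂ] EuclideanSpace ℂ (Fin (d i))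

/-- The trace of a finite-dimensional `C⋆`-algebra which takes the value `1` on every minimal
projection: the sum of the usual traces of the blocks. -/
def FinDimAlg.tr {k : ℕ} {d : Fin k → ℕ} (x : FinDimAlg d) : ℂ :=
  ∑ i : Fin k, LinearMap.trace ℂ (EuclideanSpace ℂ (Fin (d i))) (x i).toLinearMap

section Pressure

variable {A : Type*} [NonUnitalCStarAlgebra A] [PartialOrder A] [StarOrderedRing A]

/-- `Ω^(n) = Ω ∪ θ(Ω) ∪ ⋯ ∪ θ^(n-1)(Ω)`. -/
def orbitSet (θ : A →CP A) (Ω : Finset A) (n : ℕ) : Set A :=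
  {x | ∃ j < n, ∃ w ∈ Ω, x = θ^[j] w}

/-- `a^(n) = a + θ(a) + ⋯ + θ^(n-1)(a)`. -/
def orbitSum (θ : A →CP A) (a : A) (n : ℕ) : A :=
  ∑ j ∈ Finset.range n, θ^[j] a

variable {H : Type*} [NormedAddCommGroup H] [InnerProductSpace ℂ H] [CompleteSpace H]

/-- `(φ, ψ, B) ∈ CPA₀(π, S, δ)`: the completely positive maps `φ : A → B` and `ψ : B → B(H)` are
contractions with `‖ψ (φ x) - π x‖ < δ` for all `x ∈ S`. -/
structure IsCPA₀ (π : A →⋆ₙₐ[ℂ] (H →L[ℂ] H)) (S : Set A) (δ : ℝ) {k : ℕ} {d : Fin k → ℕ}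
    (φ : A →CP FinDimAlg d) (ψ : FinDimAlg d →CP (H →L[ℂ] H)) : Prop where
  norm_left_le : ∀ x, ‖φ x‖ ≤ ‖x‖
  norm_right_le : ∀ y, ‖ψ y‖ ≤ ‖y‖
  approx : ∀ x ∈ S, ‖ψ (φ x) - π x‖ < δ

/-- The partition function `Z⁰_{θ,n}(π, a, Ω, δ)`: the infimum of `Tr e^{φ(a^(n))}` over all
`(φ, ψ, B) ∈ CPA₀(π, Ω^(n), δ)` (it is `∞` if there is none). -/
def partition₀ (θ : A →CP A) (π : A →⋆ₙₐ[ℂ] (H →L[ℂ] H)) (a : A) (Ω : Finset A) (δ : ℝ)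
    (n : ℕ) : ℝ≥0∞ :=
  sInf {r | ∃ (k : ℕ) (d : Fin k → ℕ) (φ : A →CP FinDimAlg d) (ψ : FinDimAlg d →CP (H →L[ℂ] H)),
    IsCPA₀ π (orbitSet θ Ω n) δ φ ψ ∧
      r = ENNReal.ofReal (FinDimAlg.tr (NormedSpace.exp (φ (orbitSum θ a n)))).re}

/-- The approximation pressure `P⁰_θ(π, a)`, the supremum over all finite `Ω` and all `δ > 0` of
`limsup_n (1/n) log Z⁰_{θ,n}(π, a, Ω, δ)`, computed with contractive completely positive
approximations. -/
def pressure₀ (θ : A →CP A) (π : A →⋆ₙₐ[ℂ] (H →L[ℂ] H)) (a : A) : EReal :=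
  ⨆ (Ω : Finset A) (δ : ℝ) (_ : 0 < δ),
    Filter.limsup (fun n : ℕ => ENNReal.log (partition₀ θ π a Ω δ n) / (n : EReal)) Filter.atTop

end Pressure

section UnitalPressure

variable {A : Type*} [CStarAlgebra A] [PartialOrder A] [StarOrderedRing A]
variable {H : Type*} [NormedAddCommGroup H] [InnerProductSpace ℂ H] [CompleteSpace H]

/-- `(φ, ψ, B) ∈ CPA(π, S, δ)`: the completely positive maps `φ : A → B` and `ψ : B → B(H)` are
unital and `‖ψ (φ x) - π x‖ < δ` for all `x ∈ S`. -/
structure IsCPA (π : A →⋆ₐ[ℂ] (H →L[ℂ] H)) (S : Set A) (δ : ℝ) {k : ℕ} {d : Fin k → ℕ}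
    (φ : A →CP FinDimAlg d) (ψ : FinDimAlg d →CP (H →L[ℂ] H)) : Prop where
  map_one_left : φ 1 = 1
  map_one_right : ψ 1 = 1
  approx : ∀ x ∈ S, ‖ψ (φ x) - π x‖ < δ

/-- The partition function `Z_{θ,n}(π, a, Ω, δ)`: the infimum of `Tr e^{φ(a^(n))}` over all
`(φ, ψ, B) ∈ CPA(π, Ω^(n), δ)` (it is `∞` if there is none). -/
def partition (θ : A →CP A) (π : A →⋆ₐ[ℂ] (H →L[ℂ] H)) (a : A) (Ω : Finset A) (δ : ℝ)
    (n : ℕ) : ℝ≥0∞ :=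
  sInf {r | ∃ (k : ℕ) (d : Fin k → ℕ) (φ : A →CP FinDimAlg d) (ψ : FinDimAlg d →CP (H →L[ℂ] H)),
    IsCPA π (orbitSet θ Ω n) δ φ ψ ∧
      r = ENNReal.ofReal (FinDimAlg.tr (NormedSpace.exp (φ (orbitSum θ a n)))).re}

/-- The approximation pressure `P_θ(π, a)`, the supremum over all finite `Ω` and all `δ > 0` of
`limsup_n (1/n) log Z_{θ,n}(π, a, Ω, δ)`, computed with unital completely positive
approximations. -/
def pressure (θ : A →CP A) (π : A →⋆ₐ[ℂ] (H →L[ℂ] H)) (a : A) : EReal :=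
  ⨆ (Ω : Finset A) (δ : ℝ) (_ : 0 < δ),
    Filter.limsup (fun n : ℕ => ENNReal.log (partition θ π a Ω δ n) / (n : EReal)) Filter.atTop

end UnitalPressure

end NCPressure

end

/-! Unital completely positive maps are contractive, so `pressure₀ ≤ pressure`. For the converse, a
contractive pair `φ`, `ψ` with `ψ (φ 1)` within `κ ^ 4` of `1` is made unital at a cost independent
of the finite-dimensional algebra. Let `q` be the spectral projection of `φ 1` below `1 - κ ^ 2`.
Since `κ ^ 2 • q ≤ 1 - φ 1`, applying `ψ` gives `‖ψ q‖ ≤ κ ^ 2`, and by the Schwarz inequality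
cutting down by `1 - q` moves `ψ` by `O(κ)`. On the corner the compressed `φ 1` is near `1`, as is
`ψ (1 - q)`, so conjugating by inverse square roots makes both maps unital
(`exists_unital_factorization`). By Peierls' inequality, compression does not increase `Tr e^x`, and
a norm error `ε` costs a factor `e^ε` (`trace_exp_re_le`). For `orbitSum θ a n` the error is at most
`3 * κ * n * ‖a‖`, so `(1/n) log Z` rises by at most `3 * κ * ‖a‖`, and `κ` is arbitrary. -/

noncomputable section

namespace NCPressure

/-! ### Positive matrices as sums of Gram matrices -/

section MatrixPositivity

variable {A : Type*} [NonUnitalCStarAlgebra A] [PartialOrder A] [StarOrderedRing A]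

lemma exists_eq_star_mul_self_of_nonneg {x : A} (hx : 0 ≤ x) : ∃ y : A, x = star y * y :=
  CStarAlgebra.nonneg_iff_eq_star_mul_self.mp hx

lemma exists_sum_star_mul_of_cstarMatrix_nonneg {n : Type*} [Fintype n] {M : CStarMatrix n n A}
    (hM : 0 ≤ M) : ∃ N : n → n → A, ∀ i j, M i j = ∑ l, star (N l i) * N l j := by
  obtain ⟨N, rfl⟩ := exists_eq_star_mul_self_of_nonneg hM
  exact ⟨fun l i => N l i, fun i j => by rw [CStarMatrix.mul_apply]; rfl⟩

/-- Each Gram matrix is `R⋆ R`, where `R` has `c l` as row `0` and zeros elsewhere. For `k = 0`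
there is no row `0`, hence the case split. -/
lemma cstarMatrix_nonneg_of_sum_star_mul {ι : Type*} [Fintype ι] {k : ℕ}
    {M : CStarMatrix (Fin k) (Fin k) A} (c : ι → Fin k → A)
    (h : ∀ i j, M i j = ∑ l, star (c l i) * c l j) : 0 ≤ M := by
  cases k with
  | zero => exact (CStarMatrix.ext fun i => i.elim0 : (0 : CStarMatrix (Fin 0) (Fin 0) A) = M).le
  | succ k =>
    have key : M = ∑ l, star (CStarMatrix.ofMatrix fun i j => if i = 0 then c l j else 0) *
        (CStarMatrix.ofMatrix fun i j => if i = 0 then c l j else 0) := by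
      ext i j
      have hs : ∀ (s : Finset ι) (f : ι → CStarMatrix (Fin (k + 1)) (Fin (k + 1)) A),
          (∑ l ∈ s, f l) i j = ∑ l ∈ s, f l i j := by
        intro s f
        classical
        induction s using Finset.induction_on with
        | empty => simp
        | insert a s ha ih => rw [Finset.sum_insert ha, Finset.sum_insert ha, CStarMatrix.add_apply, ih]
      rw [h, hs]
      refine Finset.sum_congr rfl fun l _ => ?_
      rw [CStarMatrix.mul_apply, Finset.sum_eq_single 0]
      · change _ = star (if (0 : Fin (k + 1)) = 0 then c l i else 0) *
          (if (0 : Fin (k + 1)) = 0 then c l j else 0)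
        simp
      · intro b _ hb
        change star (if b = 0 then c l i else 0) * (if b = 0 then c l j else 0) = 0
        simp [hb]
      · simp
    rw [key]
    exact Finset.sum_nonneg fun l _ => star_mul_self_nonneg _

end MatrixPositivity

/-! ### Constructing completely positive maps -/

section CompletelyPositive

variable {A B : Type*} [NonUnitalCStarAlgebra A] [PartialOrder A] [StarOrderedRing A]
  [NonUnitalCStarAlgebra B] [PartialOrder B] [StarOrderedRing B]

/-- A linear map is completely positive if it maps the Gram matrices `(x i)⋆ (x j)` to finite sums
of Gram matrices. -/
def cpOfGram (f : A →ₗ[ℂ] B)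
    (h : ∀ (k : ℕ) (x : Fin k → A), ∃ (ι : Type) (_ : Fintype ι) (c : ι → Fin k → B),
      ∀ i j, f (star (x i) * x j) = ∑ l, star (c l i) * c l j) : A →CP B where
  toLinearMap := f
  map_cstarMatrix_nonneg' k M hM := by
    obtain ⟨N, hN⟩ := exists_sum_star_mul_of_cstarMatrix_nonneg hM
    choose ι hι c hc using fun l => h k (N l)
    refine cstarMatrix_nonneg_of_sum_star_mul (ι := Σ l : Fin k, ι l)
      (fun l => c l.1 l.2) fun i j => ?_
    rw [CStarMatrix.map_apply, hN, Fintype.sum_sigma]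
    simp [hc]

@[simp] lemma cpOfGram_apply (f : A →ₗ[ℂ] B) (h) (x : A) : cpOfGram f h x = f x := rfl

/-- Composition of completely positive maps. -/
def cpComp {C : Type*} [NonUnitalCStarAlgebra C] [PartialOrder C] [StarOrderedRing C]
    (g : B →CP C) (f : A →CP B) : A →CP C where
  toLinearMap := g.toLinearMap ∘ₗ f.toLinearMap
  map_cstarMatrix_nonneg' k M hM :=
    g.map_cstarMatrix_nonneg' k _ (f.map_cstarMatrix_nonneg' k M hM)

@[simp] lemma cpComp_apply {C : Type*} [NonUnitalCStarAlgebra C] [PartialOrder C]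
    [StarOrderedRing C] (g : B →CP C) (f : A →CP B) (x : A) : cpComp g f x = g (f x) := rfl

/-- The completely positive map `x ↦ s⋆ x s`. -/
def cpConj (s : A) : A →CP A :=
  cpOfGram (LinearMap.mulLeft ℂ (star s) ∘ₗ LinearMap.mulRight ℂ s) fun k x =>
    ⟨Unit, inferInstance, fun _ i => x i * s, fun i j => by simp [mul_assoc]⟩

@[simp] lemma cpConj_apply (s x : A) : cpConj s x = star s * x * s := by
  simp [cpConj, mul_assoc]

lemma cp_map_nonneg (f : A →CP B) {x : A} (hx : 0 ≤ x) : 0 ≤ f x := by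
  simpa using OrderHomClass.mono f hx

lemma cp_map_isSelfAdjoint (f : A →CP B) {x : A} (hx : IsSelfAdjoint x) :
    IsSelfAdjoint (f x) := by
  rw [← CFC.posPart_sub_negPart x, map_sub]
  exact (IsSelfAdjoint.of_nonneg (cp_map_nonneg f (CFC.posPart_nonneg x))).sub
    (IsSelfAdjoint.of_nonneg (cp_map_nonneg f (CFC.negPart_nonneg x)))

end CompletelyPositive

/-! ### Schwarz inequality and norm bounds -/

section Schwarz

variable {A B : Type*} [CStarAlgebra A] [PartialOrder A] [StarOrderedRing A]
  [CStarAlgebra B] [PartialOrder B] [StarOrderedRing B]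

/-- The Cauchy-Schwarz inequality for completely positive maps. -/
lemma cp_schwarz (f : A →CP B) (x y : A) (hy : ‖f (star y * y)‖ ≤ 1) :
    star (f (star y * x)) * f (star y * x) ≤ f (star x * x) := by
  have hM : 0 ≤ (CStarMatrix.ofMatrix (!![star x * x, star x * y; star y * x, star y * y]) :
      CStarMatrix (Fin 2) (Fin 2) A) := by
    refine cstarMatrix_nonneg_of_sum_star_mul (ι := Unit) (fun _ => ![x, y]) fun i j => ?_
    fin_cases i <;> fin_cases j <;> simp
  obtain ⟨N, hN⟩ := exists_sum_star_mul_of_cstarMatrix_nonneg (f.map_cstarMatrix_nonneg _ hM)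
  have h00 : f (star x * x) = ∑ l, star (N l 0) * N l 0 := hN 0 0
  have h10 : f (star y * x) = ∑ l, star (N l 1) * N l 0 := hN 1 0
  have h11 : f (star y * y) = ∑ l, star (N l 1) * N l 1 := hN 1 1
  set β := f (star y * x) with hβ
  have h01 : star β = ∑ l, star (N l 0) * N l 1 := by rw [h10]; simp
  -- Completing the square: the image of the Gram matrix of `x`, `y` is tested on the column `(1,
  -- -β)`; the bound `f (star y * y) ≤ 1` then absorbs one copy of `star β * β`.
  have h0 : 0 ≤ ∑ l, star (N l 0 - N l 1 * β) * (N l 0 - N l 1 * β) :=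
    Finset.sum_nonneg fun l _ => star_mul_self_nonneg _
  have h1 : ∑ l, star (N l 0 - N l 1 * β) * (N l 0 - N l 1 * β) =
      f (star x * x) - star β * β - star β * β + star β * f (star y * y) * β := by
    conv_rhs => rw [h00, h11]
    have e1 : star β * β = (∑ l, star (N l 0) * N l 1) * β := by rw [← h01]
    have e2 : star β * β = star β * ∑ l, star (N l 1) * N l 0 := by rw [← h10]
    nth_rw 1 [e1]
    rw [e2, Finset.sum_mul, Finset.mul_sum, Finset.mul_sum, Finset.sum_mul,
      ← Finset.sum_sub_distrib, ← Finset.sum_sub_distrib, ← Finset.sum_add_distrib]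
    refine Finset.sum_congr rfl fun l _ => ?_
    rw [star_sub, star_mul]
    noncomm_ring
  have hle : f (star y * y) ≤ 1 :=
    (CStarAlgebra.norm_le_one_iff_of_nonneg _ (cp_map_nonneg f (star_mul_self_nonneg y))).mp hy
  have h2 : star β * f (star y * y) * β ≤ star β * β := by
    simpa using star_left_conjugate_le_conjugate hle β
  rw [h1] at h0
  rw [← sub_nonneg]
  calc (0 : B) ≤ f (star x * x) - star β * β - star β * β + star β * f (star y * y) * β := h0
    _ ≤ f (star x * x) - star β * β - star β * β + star β * β := by gcongr
    _ = _ := by abel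

lemma cp_norm_sq_le (f : A →CP B) (x y : A) (hy : ‖f (star y * y)‖ ≤ 1) :
    ‖f (star y * x)‖ ^ 2 ≤ ‖f (star x * x)‖ := by
  rw [sq, ← CStarRing.norm_star_mul_self]
  exact CStarAlgebra.norm_le_norm_of_nonneg_of_le (star_mul_self_nonneg _) (cp_schwarz f x y hy)

/-- Schwarz after rescaling `y` to norm one. When `x` is a projection `q`, smallness of `f q` forces
smallness of `f (y * q)` for every `y`. -/
lemma cp_norm_mul_le (f : A →CP B) (hf : ∀ x, ‖f x‖ ≤ ‖x‖) (x y : A) :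
    ‖f (y * x)‖ ^ 2 ≤ ‖y‖ ^ 2 * ‖f (star x * x)‖ := by
  rcases eq_or_ne y 0 with rfl | hy
  · simp
  have hy' : 0 < ‖y‖ := norm_pos_iff.mpr hy
  set z : A := ((‖y‖⁻¹ : ℝ) : ℂ) • y with hz
  have hzn : ‖z‖ = 1 := by
    rw [hz, norm_smul, Complex.norm_real, norm_inv, norm_norm, inv_mul_cancel₀ hy'.ne']
  have hyz : y = (‖y‖ : ℂ) • z := by
    rw [hz, smul_smul, ← Complex.ofReal_mul, mul_inv_cancel₀ hy'.ne', Complex.ofReal_one, one_smul]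
  have h := cp_norm_sq_le f x (star z) (by
    refine (hf _).trans ?_
    rw [CStarRing.norm_star_mul_self, norm_star, hzn, one_mul])
  rw [star_star] at h
  conv_lhs => rw [hyz]
  rw [smul_mul_assoc, map_smul, norm_smul, Complex.norm_real, norm_norm, mul_pow]
  gcongr

lemma cp_norm_mul_le' (f : A →CP B) (hf : ∀ x, ‖f x‖ ≤ ‖x‖) (x y : A) :
    ‖f (star x * y)‖ ^ 2 ≤ ‖y‖ ^ 2 * ‖f (star x * x)‖ := by
  have h : f (star x * y) = star (f (star y * x)) := by
    rw [← map_star f, star_mul, star_star]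
  rw [h, norm_star, ← norm_star y]
  exact cp_norm_mul_le f hf x (star y)

/-- Schwarz with `y = 1` reduces the bound to `star x * x ≤ ‖x‖ ^ 2 • 1`, where monotonicity
suffices. -/
lemma cp_norm_le (f : A →CP B) (h1 : ‖f 1‖ ≤ 1) (x : A) : ‖f x‖ ≤ ‖x‖ := by
  have h := cp_norm_sq_le f x 1 (by simpa using h1)
  have h2 : f (star x * x) ≤ (‖x‖ ^ 2) • (1 : B) := by
    have : star x * x ≤ ((‖x‖ ^ 2 : ℝ) : ℂ) • (1 : A) := by
      have := CStarAlgebra.star_mul_le_algebraMap_norm_sq (a := x)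
      rwa [Algebra.algebraMap_eq_smul_one, ← Complex.coe_smul] at this
    have h3 := OrderHomClass.mono f this
    rw [map_smul, Complex.coe_smul] at h3
    refine h3.trans (smul_le_smul_of_nonneg_left ?_ (by positivity))
    exact (CStarAlgebra.norm_le_one_iff_of_nonneg _ (cp_map_nonneg f zero_le_one)).mp h1
  have h3 : ‖f (star x * x)‖ ≤ ‖x‖ ^ 2 := by
    refine (CStarAlgebra.norm_le_iff_le_algebraMap _ (by positivity)
      (cp_map_nonneg f (star_mul_self_nonneg x))).mpr ?_
    rwa [Algebra.algebraMap_eq_smul_one]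
  rw [star_one, one_mul] at h
  exact (sq_le_sq₀ (norm_nonneg _) (norm_nonneg _)).mp (h.trans h3)

end Schwarz

/-! ### Peierls inequality and spectral subspaces of matrices -/

section Spectral

open Module ContinuousLinearMap

variable {E F : Type*} [NormedAddCommGroup E] [InnerProductSpace ℂ E]
  [NormedAddCommGroup F] [InnerProductSpace ℂ F]

lemma re_inner_apply_self_eq_sum {ι : Type*} [Fintype ι] {T : E →L[ℂ] E}
    {g : OrthonormalBasis ι ℂ E} {t : ι → ℝ} (h : ∀ k, T (g k) = (t k : ℂ) • g k) (v : E) :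
    (inner ℂ (T v) v).re = ∑ k, t k * ‖g.repr v k‖ ^ 2 := by
  have hr : T v = ∑ k, (g.repr v k * t k) • g k := by
    conv_lhs => rw [← g.sum_repr v, map_sum]
    simp_rw [map_smul, h, smul_smul]
  rw [hr, sum_inner, Complex.re_sum]
  refine Finset.sum_congr rfl fun k _ => ?_
  rw [inner_smul_left, ← g.repr_apply_apply, map_mul, Complex.conj_ofReal, mul_right_comm,
    ← Complex.normSq_eq_conj_mul_self, ← Complex.ofReal_mul, Complex.ofReal_re,
    Complex.normSq_eq_norm_sq, mul_comm]

lemma norm_sq_eq_sum_repr {ι : Type*} [Fintype ι] (g : OrthonormalBasis ι ℂ E) (v : E) :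
    ‖v‖ ^ 2 = ∑ k, ‖g.repr v k‖ ^ 2 := by
  rw [← g.repr.norm_map v, EuclideanSpace.norm_sq_eq]

/-- The Peierls inequality. -/
lemma exp_re_inner_le_sum {ι : Type*} [Fintype ι] {T : E →L[ℂ] E}
    {g : OrthonormalBasis ι ℂ E} {t : ι → ℝ} (h : ∀ k, T (g k) = (t k : ℂ) • g k) {v : E}
    (hv : ‖v‖ = 1) :
    Real.exp (inner ℂ (T v) v).re ≤ ∑ k, ‖g.repr v k‖ ^ 2 * Real.exp (t k) := by
  rw [re_inner_apply_self_eq_sum h]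
  -- Jensen for `exp`: the weights sum to `‖v‖ ^ 2 = 1`.
  have := convexOn_exp.map_sum_le (t := Finset.univ) (w := fun k => ‖g.repr v k‖ ^ 2) (p := t)
    (fun _ _ => by positivity) (by rw [← norm_sq_eq_sum_repr, hv, one_pow]) (by simp)
  simpa [mul_comm] using this

variable [FiniteDimensional ℂ E] [FiniteDimensional ℂ F]

lemma exists_eigenbasis {T : E →L[ℂ] E} (hT : IsSelfAdjoint T) :
    ∃ (g : OrthonormalBasis (Fin (finrank ℂ E)) ℂ E) (t : Fin (finrank ℂ E) → ℝ),
      ∀ k, T (g k) = (t k : ℂ) • g k :=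
  ⟨hT.isSymmetric.eigenvectorBasis rfl, hT.isSymmetric.eigenvalues rfl,
    hT.isSymmetric.apply_eigenvectorBasis rfl⟩

lemma exp_apply_of_apply_eq_smul {T : E →L[ℂ] E} {v : E} {t : ℂ} (h : T v = t • v) :
    NormedSpace.exp T v = Complex.exp t • v := by
  have hp : ∀ n : ℕ, (T ^ n) v = t ^ n • v := by
    intro n
    induction n with
    | zero => simp
    | succ n ih => 
      rw [pow_succ']
      change T ((T ^ n) v) = _
      rw [ih, map_smul, h, smul_smul, pow_succ]
  have h1 := (NormedSpace.exp_series_hasSum_exp' (𝕂 := ℂ) T).mapL (apply ℂ E v)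
  have h2 := (NormedSpace.exp_series_hasSum_exp' (𝕂 := ℂ) t).smul_const v
  rw [← Complex.exp_eq_exp_ℂ] at h2
  refine h1.unique ?_
  convert h2 using 2 with n
  simp [hp, smul_smul]

lemma trace_exp_re_eq_sum {ι : Type*} [Fintype ι] {T : E →L[ℂ] E}
    {g : OrthonormalBasis ι ℂ E} {t : ι → ℝ} (h : ∀ k, T (g k) = (t k : ℂ) • g k) :
    (LinearMap.trace ℂ E (NormedSpace.exp T).toLinearMap).re = ∑ k, Real.exp (t k) := by
  rw [LinearMap.trace_eq_sum_inner _ g, Complex.re_sum]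
  refine Finset.sum_congr rfl fun k _ => ?_
  rw [coe_coe, exp_apply_of_apply_eq_smul (h k), inner_smul_right, inner_self_eq_norm_sq_to_K,
    g.orthonormal.1 k]
  simp [Complex.exp_ofReal_re]

/-- Peierls is applied to the unit vectors `V (f j)`, with `f` an eigenbasis of `X`. Summed over
`j`, the weight of the eigenvector `g k` of `T` is `‖V† (g k)‖ ^ 2 ≤ 1`. -/
lemma trace_exp_re_le {T : E →L[ℂ] E} (hT : IsSelfAdjoint T) {X : F →L[ℂ] F}
    (hX : IsSelfAdjoint X) {V : F →L[ℂ] E} (hV : adjoint V ∘L V = 1) {ε : ℝ}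
    (h : ∀ v, (inner ℂ (X v) v).re ≤ (inner ℂ (T (V v)) (V v)).re + ε * ‖v‖ ^ 2) :
    (LinearMap.trace ℂ F (NormedSpace.exp X).toLinearMap).re ≤
      Real.exp ε * (LinearMap.trace ℂ E (NormedSpace.exp T).toLinearMap).re := by
  obtain ⟨g, t, hg⟩ := exists_eigenbasis hT
  obtain ⟨f, x, hf⟩ := exists_eigenbasis hX
  rw [trace_exp_re_eq_sum hg, trace_exp_re_eq_sum hf]
  have hiso : ∀ v, ‖V v‖ = ‖v‖ := (norm_map_iff_adjoint_comp_self V).mpr hV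
  have hadj : ∀ w, ‖adjoint V w‖ ≤ ‖w‖ := by
    intro w
    refine (le_opNorm _ _).trans ?_
    rw [LinearIsometryEquiv.norm_map]
    exact mul_le_of_le_one_left (norm_nonneg _)
      (opNorm_le_bound _ zero_le_one fun v => by rw [hiso, one_mul])
  have hx : ∀ j, x j = (inner ℂ (X (f j)) (f j)).re := by
    intro j
    rw [hf, inner_smul_left, inner_self_eq_norm_sq_to_K, f.orthonormal.1 j]
    simp
  have hcol : ∀ k, ∑ j, ‖g.repr (V (f j)) k‖ ^ 2 ≤ 1 := by
    intro k
    have : ∀ j, ‖g.repr (V (f j)) k‖ = ‖f.repr (adjoint V (g k)) j‖ := by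
      intro j
      rw [g.repr_apply_apply, f.repr_apply_apply, adjoint_inner_right, norm_inner_symm]
    simp_rw [this]
    rw [← norm_sq_eq_sum_repr]
    have := hadj (g k)
    rw [g.orthonormal.1 k] at this
    exact pow_le_one₀ (norm_nonneg _) this
  calc ∑ j, Real.exp (x j)
      ≤ ∑ j, Real.exp ε * ∑ k, ‖g.repr (V (f j)) k‖ ^ 2 * Real.exp (t k) := by
        refine Finset.sum_le_sum fun j _ => ?_
        have h1 := h (f j)
        rw [f.orthonormal.1 j, one_pow, mul_one, ← hx] at h1
        refine (Real.exp_le_exp.mpr h1).trans ?_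
        rw [Real.exp_add, mul_comm]
        exact mul_le_mul_of_nonneg_left
          (exp_re_inner_le_sum hg (by rw [hiso, f.orthonormal.1 j])) (Real.exp_nonneg _)
    _ = Real.exp ε * ∑ k, (∑ j, ‖g.repr (V (f j)) k‖ ^ 2) * Real.exp (t k) := by
        rw [← Finset.mul_sum, Finset.sum_comm]
        simp_rw [Finset.sum_mul]
    _ ≤ Real.exp ε * ∑ k, Real.exp (t k) := by
        refine mul_le_mul_of_nonneg_left (Finset.sum_le_sum fun k _ => ?_) (Real.exp_nonneg _)
        exact mul_le_of_le_one_left (Real.exp_nonneg _) (hcol k)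

/-- A positive contraction `T` is nearly the identity on its spectral subspace for `[1 - η, 1]`,
which is the range of an isometry `V`. -/
lemma exists_isometry_onto_spectral_subspace {T : E →L[ℂ] E} (hT : IsSelfAdjoint T) (hT1 : T ≤ 1)
    (η : ℝ) :
    ∃ (m : ℕ) (V : EuclideanSpace ℂ (Fin m) →L[ℂ] E), adjoint V ∘L V = 1 ∧
      (η : ℂ) • (1 - V ∘L adjoint V) ≤ 1 - T ∧ ((1 - η : ℝ) : ℂ) • 1 ≤ adjoint V ∘L T ∘L V := by
  obtain ⟨g, t, hg⟩ := exists_eigenbasis hT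
  have ht1 : ∀ k, t k ≤ 1 := by
    intro k
    have h1 := ((le_def _ _).mp hT1).2 (g k)
    rw [reApplyInnerSelf_apply, sub_apply, hg, inner_sub_left, inner_smul_left, one_apply_eq_self,
      inner_self_eq_norm_sq_to_K, g.orthonormal.1 k] at h1
    simpa using h1
  -- `V` sends the standard basis to the eigenvectors indexed by `J`. Off `J`, `1 - t k > η` yields
  -- the first operator inequality; on `J`, `t k ≥ 1 - η` yields the second.
  let J : Finset (Fin (finrank ℂ E)) := Finset.univ.filter fun k => 1 - η ≤ t k
  let ι : Fin J.card ≃ J := J.equivFin.symm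
  have hι : Function.Injective fun j => (ι j : Fin (finrank ℂ E)) :=
    Subtype.val_injective.comp ι.injective
  have ho : Orthonormal ℂ fun j => g (ι j) := g.orthonormal.comp _ hι
  let V : EuclideanSpace ℂ (Fin J.card) →L[ℂ] E :=
    LinearMap.toContinuousLinearMap
      (Fintype.linearCombination ℂ (fun j => g (ι j)) ∘ₗ
        (WithLp.linearEquiv 2 ℂ (Fin J.card → ℂ)).toLinearMap)
  have hVapp : ∀ w, V w = ∑ j, w j • g (ι j) := fun w => by
    simp [V, Fintype.linearCombination_apply]
  have hadj : ∀ v j, (adjoint V v) j = g.repr v (ι j) := by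
    intro v j
    have : (adjoint V v) j = inner ℂ (EuclideanSpace.single j (1 : ℂ)) (adjoint V v) := by
      simp [EuclideanSpace.inner_single_left]
    rw [this, adjoint_inner_right, hVapp, g.repr_apply_apply]
    simp
  have hsum : ∀ f : Fin (finrank ℂ E) → ℝ, ∑ j, f (ι j) = ∑ k ∈ J, f k := by
    intro f
    rw [Equiv.sum_comp ι (fun k : J => f k), Finset.sum_coe_sort J f]
  have hVV : adjoint V ∘L V = 1 := by
    ext w j
    rw [comp_apply, hadj, hVapp, g.repr_apply_apply, one_apply_eq_self]
    exact ho.inner_right_fintype _ _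
  have hiso : ∀ v, ‖V v‖ = ‖v‖ := (norm_map_iff_adjoint_comp_self V).mpr hVV
  have hVout : ∀ w k, k ∉ J → g.repr (V w) k = 0 := by
    intro w k hk
    rw [hVapp, g.repr_apply_apply, inner_sum]
    refine Finset.sum_eq_zero fun j _ => ?_
    rw [inner_smul_right, g.orthonormal.2, mul_zero]
    rintro rfl
    exact hk (ι j).2
  refine ⟨J.card, V, hVV, (le_def _ _).mpr ⟨?_, fun v => ?_⟩, (le_def _ _).mpr ⟨?_, fun w => ?_⟩⟩
  · refine IsSelfAdjoint.isSymmetric ?_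
    refine ((IsSelfAdjoint.one _).sub hT).sub (.smul (by simp [isSelfAdjoint_iff]) (.sub (.one _) ?_))
    simp [isSelfAdjoint_iff, star_eq_adjoint, adjoint_comp]
  · have h1 : (inner ℂ (T v) v).re = ∑ k, t k * ‖g.repr v k‖ ^ 2 := re_inner_apply_self_eq_sum hg v
    have h2 : (inner ℂ (V (adjoint V v)) v).re = ∑ k ∈ J, ‖g.repr v k‖ ^ 2 := by
      rw [← adjoint_inner_right, inner_self_eq_norm_sq_to_K, ← hsum fun k => ‖g.repr v k‖ ^ 2]
      simp_rw [← hadj]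
      rw [← EuclideanSpace.norm_sq_eq]
      norm_cast
    have h3 : (inner ℂ v v).re = ∑ k, ‖g.repr v k‖ ^ 2 := by
      rw [← norm_sq_eq_sum_repr, inner_self_eq_norm_sq_to_K]
      norm_cast
    have h4 : ∑ k, ‖g.repr v k‖ ^ 2 = ∑ k ∈ J, ‖g.repr v k‖ ^ 2 + ∑ k ∈ Jᶜ, ‖g.repr v k‖ ^ 2 :=
      (Finset.sum_add_sum_compl _ _).symm
    have h5 : ∑ k, (1 - t k) * ‖g.repr v k‖ ^ 2 =
        ∑ k ∈ J, (1 - t k) * ‖g.repr v k‖ ^ 2 + ∑ k ∈ Jᶜ, (1 - t k) * ‖g.repr v k‖ ^ 2 :=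
      (Finset.sum_add_sum_compl _ _).symm
    have h6 : 0 ≤ ∑ k ∈ J, (1 - t k) * ‖g.repr v k‖ ^ 2 :=
      Finset.sum_nonneg fun k _ => mul_nonneg (sub_nonneg.mpr (ht1 k)) (by positivity)
    have h7 : η * ∑ k ∈ Jᶜ, ‖g.repr v k‖ ^ 2 ≤ ∑ k ∈ Jᶜ, (1 - t k) * ‖g.repr v k‖ ^ 2 := by
      rw [Finset.mul_sum]
      refine Finset.sum_le_sum fun k hk => mul_le_mul_of_nonneg_right ?_ (by positivity)
      have : ¬ 1 - η ≤ t k := by simpa [J] using hk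
      linarith
    have h8 : ∑ k, (1 - t k) * ‖g.repr v k‖ ^ 2 =
        ∑ k, ‖g.repr v k‖ ^ 2 - ∑ k, t k * ‖g.repr v k‖ ^ 2 := by
      rw [← Finset.sum_sub_distrib]
      exact Finset.sum_congr rfl fun k _ => by ring
    have h9 : reApplyInnerSelf (1 - T - (η : ℂ) • (1 - V ∘L adjoint V)) v =
        (inner ℂ v v).re - (inner ℂ (T v) v).re -
          η * ((inner ℂ v v).re - (inner ℂ (V (adjoint V v)) v).re) := by
      change (inner ℂ (v - T v - (η : ℂ) • (v - V (adjoint V v))) v).re = _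
      rw [inner_sub_left, inner_sub_left, inner_smul_left, inner_sub_left, Complex.conj_ofReal]
      simp only [Complex.sub_re, Complex.re_ofReal_mul]
    rw [h9, h1, h2, h3, ← h8, h5, h4, add_sub_cancel_left]
    linarith
  · refine IsSelfAdjoint.isSymmetric ?_
    refine IsSelfAdjoint.sub ?_ (.smul (by simp [isSelfAdjoint_iff]) (.one _))
    rw [isSelfAdjoint_iff, star_eq_adjoint, adjoint_comp, adjoint_comp, adjoint_adjoint,
      hT.adjoint_eq, comp_assoc]
  · have h1 : (inner ℂ (T (V w)) (V w)).re = ∑ k, t k * ‖g.repr (V w) k‖ ^ 2 :=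
      re_inner_apply_self_eq_sum hg _
    have h2 : (inner ℂ w w).re = ∑ k, ‖g.repr (V w) k‖ ^ 2 := by
      rw [← norm_sq_eq_sum_repr, inner_self_eq_norm_sq_to_K, hiso]
      norm_cast
    have h3 : (1 - η) * ∑ k, ‖g.repr (V w) k‖ ^ 2 ≤ ∑ k, t k * ‖g.repr (V w) k‖ ^ 2 := by
      rw [Finset.mul_sum]
      refine Finset.sum_le_sum fun k _ => ?_
      by_cases hk : k ∈ J
      · exact mul_le_mul_of_nonneg_right (by simpa [J] using hk) (by positivity)
      · simp [hVout w k hk]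
    have h4 : reApplyInnerSelf (adjoint V ∘L T ∘L V - ((1 - η : ℝ) : ℂ) • 1) w =
        (inner ℂ (T (V w)) (V w)).re - (1 - η) * (inner ℂ w w).re := by
      simp [reApplyInnerSelf_apply, inner_sub_left, inner_smul_left, adjoint_inner_left]
    rw [h4, h1, h2]
    linarith

end Spectral

/-! ### Inverse square roots near the identity -/

section Normalization

variable {E : Type*} [CStarAlgebra E]

/-- An element near `1` has an inverse square root near `1`. -/
lemma exists_mul_mul_self_eq_one {c : E} (hc : IsSelfAdjoint c) {η : ℝ}
    (hη : η ≤ 1 / 2) (h : ‖c - 1‖ ≤ η) :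
    ∃ s : E, IsSelfAdjoint s ∧ s * c * s = 1 ∧ ‖s - 1‖ ≤ 2 * η ∧ ‖s‖ ≤ 2 := by
  have hη0 : 0 ≤ η := (norm_nonneg _).trans h
  have hspec : ∀ x ∈ spectrum ℝ c, |x - 1| ≤ η := by
    intro x hx
    have h1 : cfc (fun x : ℝ => x - 1) c = c - 1 := by
      rw [cfc_sub .., cfc_id' ℝ c, cfc_const_one ℝ c]
    have h2 := norm_apply_le_norm_cfc (fun x : ℝ => x - 1) c hx
    rw [h1] at h2
    exact h2.trans h
  have hpos : ∀ x ∈ spectrum ℝ c, 1 / 2 ≤ x := fun x hx => by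
    linarith [(abs_le.mp (hspec x hx)).1]
  have hcont : ContinuousOn (fun x : ℝ => (√x)⁻¹) (spectrum ℝ c) := by
    refine ContinuousOn.inv₀ (by fun_prop) fun x hx => ?_
    exact (Real.sqrt_pos.mpr (by linarith [hpos x hx])).ne'
  have hb : ∀ x ∈ spectrum ℝ c, |(√x)⁻¹ - 1| ≤ 2 * η := by
    intro x hx
    have h0 := hpos x hx
    set y := (√x)⁻¹ with hy
    have hy0 : 0 < y := inv_pos.mpr (Real.sqrt_pos.mpr (by linarith))
    have hyx : y ^ 2 * x = 1 := by
      rw [hy, inv_pow, Real.sq_sqrt (by linarith), inv_mul_cancel₀ (by linarith)]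
    have hx1 := abs_le.mp (hspec x hx)
    -- As `y ^ 2 * x = 1`, `(y - 1) * (y + 1) = y ^ 2 * (1 - x)`. The constant `2` in `2 * η` is the
    -- bound on `y ^ 2 = 1 / x` for `x ≥ 1 / 2`.
    have h1 : |y - 1| * (y + 1) = y ^ 2 * |x - 1| := by
      rw [← abs_of_pos (show 0 < y + 1 by linarith), ← abs_mul,
        ← abs_of_nonneg (sq_nonneg y), ← abs_mul, ← abs_neg]
      congr 1
      linarith
    have h2 : y ^ 2 ≤ 2 := by nlinarith
    have h3 : |y - 1| * 1 ≤ |y - 1| * (y + 1) :=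
      mul_le_mul_of_nonneg_left (by linarith) (abs_nonneg _)
    have h4 : y ^ 2 * |x - 1| ≤ 2 * η := mul_le_mul h2 (hspec x hx) (abs_nonneg _) (by norm_num)
    linarith
  refine ⟨cfc (fun x : ℝ => (√x)⁻¹) c, cfc_predicate _ _, ?_, ?_, ?_⟩
  · conv_lhs => enter [1, 2]; rw [← cfc_id' ℝ c]
    rw [← cfc_mul (fun x : ℝ => (√x)⁻¹) (fun x => x) c hcont continuousOn_id,
      ← cfc_mul (fun x : ℝ => (√x)⁻¹ * x) (fun x => (√x)⁻¹) c (hcont.mul continuousOn_id) hcont,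
      ← cfc_const_one ℝ c]
    refine cfc_congr fun x hx => ?_
    have h0 : 0 < x := by linarith [hpos x hx]
    have h1 : √x * √x = x := Real.mul_self_sqrt h0.le
    have h2 : √x ≠ 0 := (Real.sqrt_pos.mpr h0).ne'
    field_simp
    rw [sq, h1]
  · have h1 : cfc (fun x : ℝ => (√x)⁻¹) c - 1 = cfc (fun x : ℝ => (√x)⁻¹ - 1) c := by
      rw [cfc_sub (fun x : ℝ => (√x)⁻¹) (fun _ => 1) c hcont continuousOn_const,
        cfc_const_one ℝ c]
    rw [h1]
    exact norm_cfc_le (by positivity) hb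
  · refine norm_cfc_le (by positivity) fun x hx => ?_
    have := abs_le.mp (hb x hx)
    rw [Real.norm_eq_abs, abs_le]
    constructor <;> linarith [this.1, this.2]

lemma norm_mul_mul_self_sub_le {s z : E} {κ : ℝ} (h1 : ‖s - 1‖ ≤ κ) (h2 : ‖s‖ ≤ 2) :
    ‖s * z * s - z‖ ≤ 3 * κ * ‖z‖ := by
  have e : s * z * s - z = (s - 1) * z * s + z * (s - 1) := by noncomm_ring
  have hκ : 0 ≤ κ := (norm_nonneg _).trans h1
  rw [e]
  calc ‖(s - 1) * z * s + z * (s - 1)‖ ≤ ‖s - 1‖ * ‖z‖ * ‖s‖ + ‖z‖ * ‖s - 1‖ :=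
        (norm_add_le _ _).trans (add_le_add
          ((norm_mul_le _ _).trans (mul_le_mul_of_nonneg_right (norm_mul_le _ _) (norm_nonneg _)))
          (norm_mul_le _ _))
    _ ≤ κ * ‖z‖ * 2 + ‖z‖ * κ := by gcongr
    _ = _ := by ring

end Normalization

/-! ### Conjugation between block algebras -/

section BlockCompression

open ContinuousLinearMap

/-- Turns `X† Y`, which factors through `E`, into a Gram sum inside the algebra of operators on `F`.
With `u` a unit vector of `F`, the rank-one maps `R l = ⟨b l, ·⟩ u` satisfy `∑ (R l)† (R l) = 1` by
Parseval. -/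
lemma exists_adjoint_comp_eq_sum_star_mul {ι E F : Type*} [Fintype ι]
    [NormedAddCommGroup E] [InnerProductSpace ℂ E] [CompleteSpace E]
    [NormedAddCommGroup F] [InnerProductSpace ℂ F] [CompleteSpace F]
    (b : OrthonormalBasis ι ℂ E) :
    ∃ R : ι → (E →L[ℂ] F), ∀ X Y : F →L[ℂ] E,
      adjoint X ∘L Y = ∑ l, star (R l ∘L X) * (R l ∘L Y) := by
  rcases subsingleton_or_nontrivial F with hF | hF
  · exact ⟨0, fun X Y => Subsingleton.elim _ _⟩
  · obtain ⟨u, hu⟩ := exists_norm_eq F zero_le_one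
    refine ⟨fun l => (innerSL ℂ (b l)).smulRight u, fun X Y => ?_⟩
    ext v
    refine ext_inner_left ℂ fun w => ?_
    rw [comp_apply, adjoint_inner_right, ← b.sum_inner_mul_inner, sum_apply, inner_sum]
    refine Finset.sum_congr rfl fun l _ => ?_
    have e : ∀ S T : F →L[ℂ] F, inner ℂ w ((star S * T) v) = inner ℂ (S w) (T v) :=
      fun S T => adjoint_inner_right S w (T v)
    rw [e]
    simp [hu, mul_comm]

variable {k : ℕ} {d d' : Fin k → ℕ}

/-- The map `x ↦ (W i)† (x i) (W i)` as a linear map between finite-dimensional algebras. -/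
def blockConjₗ (W : ∀ i, EuclideanSpace ℂ (Fin (d' i)) →L[ℂ] EuclideanSpace ℂ (Fin (d i))) :
    FinDimAlg d →ₗ[ℂ] FinDimAlg d' where
  toFun x i := adjoint (W i) ∘L x i ∘L W i
  map_add' x y := by ext; simp
  map_smul' c x := by ext; simp

/-- The completely positive map `x ↦ (W i)† (x i) (W i)`. -/
def blockConj (W : ∀ i, EuclideanSpace ℂ (Fin (d' i)) →L[ℂ] EuclideanSpace ℂ (Fin (d i))) :
    FinDimAlg d →CP FinDimAlg d' :=
  cpOfGram (blockConjₗ W) fun m x => by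
    choose R hR using fun i => exists_adjoint_comp_eq_sum_star_mul
      (F := EuclideanSpace ℂ (Fin (d' i))) (EuclideanSpace.basisFun (Fin (d i)) ℂ)
    -- Each family is supported in one block, so a given block `j` only sees the indices `⟨j, l⟩`.
    refine ⟨Σ i, Fin (d i), inferInstance,
      fun p a => Pi.single p.1 (R p.1 p.2 ∘L x a p.1 ∘L W p.1), fun a b => ?_⟩
    funext j
    rw [Fintype.sum_sigma, Finset.sum_apply, Finset.sum_eq_single j]
    · rw [Finset.sum_apply]
      simp only [Pi.mul_apply, Pi.star_apply, Pi.single_eq_same]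
      refine Eq.trans ?_ (hR j (x a j ∘L W j) (x b j ∘L W j))
      rw [adjoint_comp]
      rfl
    · intro i _ hij
      rw [Finset.sum_apply]
      refine Finset.sum_eq_zero fun l _ => ?_
      simp only [Pi.mul_apply, Pi.single_eq_of_ne hij.symm, mul_zero]
    · simp

lemma blockConj_apply
    (W : ∀ i, EuclideanSpace ℂ (Fin (d' i)) →L[ℂ] EuclideanSpace ℂ (Fin (d i)))
    (x : FinDimAlg d) (i : Fin k) : blockConj W x i = adjoint (W i) ∘L x i ∘L W i := rfl

/-- Only an inequality, because zero algebras are allowed. -/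
lemma norm_one_le_one {E : Type*} [CStarAlgebra E] : ‖(1 : E)‖ ≤ 1 := by
  rcases subsingleton_or_nontrivial E with h | h
  · rw [Subsingleton.elim (1 : E) 0, norm_zero]
    exact zero_le_one
  · exact CStarRing.norm_one.le

end BlockCompression

lemma ofReal_smul_nonneg {E : Type*} [CStarAlgebra E] [PartialOrder E] [StarOrderedRing E]
    {r : ℝ} (hr : 0 ≤ r) {x : E} (hx : 0 ≤ x) : 0 ≤ (r : ℂ) • x := by
  rw [Complex.coe_smul]
  exact smul_nonneg hr hx

/-! ### The projection complementary to the range of an isometry -/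

section Projection

open ContinuousLinearMap

variable {E F : Type*} [NormedAddCommGroup E] [InnerProductSpace ℂ E] [CompleteSpace E]
  [NormedAddCommGroup F] [InnerProductSpace ℂ F] [CompleteSpace F]

lemma star_one_sub_comp_adjoint (V : F →L[ℂ] E) :
    star (1 - V ∘L adjoint V) = 1 - V ∘L adjoint V := by
  rw [star_sub, star_one, star_eq_adjoint, adjoint_comp, adjoint_adjoint]

lemma star_one_sub_comp_adjoint_mul_self {V : F →L[ℂ] E} (hV : adjoint V ∘L V = 1) :
    star (1 - V ∘L adjoint V) * (1 - V ∘L adjoint V) = 1 - V ∘L adjoint V := by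
  have hVV : ∀ v, adjoint V (V v) = v := fun v => congrArg (fun f => f v) hV
  rw [star_one_sub_comp_adjoint]
  ext v
  simp [hVV]

end Projection

/-! ### Spectral compression and traces of exponentials -/

section Compression

open ContinuousLinearMap

variable {k : ℕ} {d d' : Fin k → ℕ}

/-- Compression of a finite-dimensional algebra to a spectral projection of a positive contraction
`b`, realised by isometries `V i`. -/
lemma exists_block_compression {b : FinDimAlg d} (hb0 : 0 ≤ b) (hb1 : b ≤ 1) {η : ℝ}
    (hη : 0 ≤ η) :
    ∃ (d' : Fin k → ℕ) (V : ∀ i, EuclideanSpace ℂ (Fin (d' i)) →L[ℂ] EuclideanSpace ℂ (Fin (d i)))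
      (q : FinDimAlg d),
      (∀ i, adjoint (V i) ∘L V i = 1) ∧ blockConj V 1 = 1 ∧
      (∀ x, blockConj (fun i => adjoint (V i)) (blockConj V x) = (1 - q) * x * (1 - q)) ∧
      star q = q ∧ star q * q = q ∧ blockConj (fun i => adjoint (V i)) 1 = 1 - q ∧
      (η : ℂ) • q ≤ 1 - b ∧ ‖blockConj V b - 1‖ ≤ η := by
  choose d' V hV hq hc using fun i => exists_isometry_onto_spectral_subspace
    (IsSelfAdjoint.of_nonneg (hb0 i)) (hb1 i) η
  have hV1 : blockConj V 1 = 1 := by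
    funext i
    exact hV i
  -- `q` is the spectral projection of `b` below `1 - η`, so compressing by `V` and then including
  -- back is the cut-down by `1 - q`.
  refine ⟨d', V, fun i => 1 - V i ∘L adjoint (V i), hV, hV1, fun x => ?_, ?_, ?_, ?_, hq, ?_⟩
  · funext i
    rw [blockConj_apply, blockConj_apply, adjoint_adjoint]
    ext v
    simp
  · funext i
    exact star_one_sub_comp_adjoint (V i)
  · funext i
    exact star_one_sub_comp_adjoint_mul_self (hV i)
  · funext i
    rw [blockConj_apply, adjoint_adjoint]
    ext v
    simp
  · have h1 : blockConj V b ≤ 1 := hV1 ▸ OrderHomClass.mono (blockConj V) hb1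
    have h2 : 1 - blockConj V b ≤ algebraMap ℝ _ η := by
      intro i
      have h3 := hc i
      rw [Pi.sub_apply, Pi.one_apply, blockConj_apply, sub_le_comm]
      refine le_trans (le_of_eq ?_) h3
      rw [Complex.ofReal_sub, sub_smul, Complex.ofReal_one, one_smul, Pi.algebraMap_apply,
        Algebra.algebraMap_eq_smul_one, Complex.coe_smul]
    rw [norm_sub_rev]
    exact (CStarAlgebra.norm_le_iff_le_algebraMap _ hη (sub_nonneg.mpr h1)).mpr h2

lemma FinDimAlg.exp_apply (x : FinDimAlg d) (i : Fin k) :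
    NormedSpace.exp x i = NormedSpace.exp (x i) := by
  let : ∀ i, NormedAlgebra ℚ
      (EuclideanSpace ℂ (Fin (d i)) →L[ℂ] EuclideanSpace ℂ (Fin (d i))) :=
    fun i => NormedAlgebra.restrictScalars ℚ ℂ _
  exact Pi.coe_exp x i

lemma FinDimAlg.tr_re_exp_le {x : FinDimAlg d} {y : FinDimAlg d'} (hx : IsSelfAdjoint x)
    (hy : IsSelfAdjoint y)
    {V : ∀ i, EuclideanSpace ℂ (Fin (d' i)) →L[ℂ] EuclideanSpace ℂ (Fin (d i))}
    (hV : ∀ i, adjoint (V i) ∘L V i = 1) {ε : ℝ} (h : ‖y - blockConj V x‖ ≤ ε) :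
    (FinDimAlg.tr (NormedSpace.exp y)).re ≤
      Real.exp ε * (FinDimAlg.tr (NormedSpace.exp x)).re := by
  rw [FinDimAlg.tr, FinDimAlg.tr, Complex.re_sum, Complex.re_sum, Finset.mul_sum]
  refine Finset.sum_le_sum fun i _ => ?_
  rw [FinDimAlg.exp_apply, FinDimAlg.exp_apply]
  refine trace_exp_re_le (congrFun hx i) (congrFun hy i) (hV i) fun v => ?_
  have h1 : (inner ℂ (y i v) v).re - (inner ℂ (x i (V i v)) (V i v)).re =
      (inner ℂ ((y - blockConj V x) i v) v).re := by
    rw [Pi.sub_apply, sub_apply, inner_sub_left, Complex.sub_re, blockConj_apply, comp_apply,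
      comp_apply, adjoint_inner_left]
  have h2 : (inner ℂ ((y - blockConj V x) i v) v).re ≤ ε * ‖v‖ ^ 2 := by
    refine (Complex.re_le_norm _).trans ((norm_inner_le_norm _ _).trans ?_)
    rw [sq, ← mul_assoc]
    refine mul_le_mul_of_nonneg_right ?_ (norm_nonneg _)
    refine (le_opNorm _ _).trans (mul_le_mul_of_nonneg_right ?_ (norm_nonneg _))
    exact (norm_le_pi_norm _ i).trans h
  linarith

end Compression

/-! ### Making contractive factorizations unital -/

section Unitalization

variable {A D D' B : Type*} [CStarAlgebra A] [PartialOrder A] [StarOrderedRing A]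
  [CStarAlgebra B] [PartialOrder B] [StarOrderedRing B]
  [CStarAlgebra D] [PartialOrder D] [StarOrderedRing D]
  [CStarAlgebra D'] [PartialOrder D'] [StarOrderedRing D']

/-- The difference is `-(q * y + (1 - q) * y * q)` under `ψ`. Each term has a factor `q`, so Schwarz
bounds it by the square root of `‖ψ q‖` times `‖y‖`. -/
lemma cp_norm_compression_sub_le {ψ : D →CP B} (hψ : ∀ y, ‖ψ y‖ ≤ ‖y‖) {q : D}
    (hqs : star q = q) (hqq : star q * q = q) (hp : ‖1 - q‖ ≤ 1) {κ : ℝ} (hκ : 0 ≤ κ)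
    (hq : ‖ψ q‖ ≤ κ ^ 2) (y : D) : ‖ψ ((1 - q) * y * (1 - q)) - ψ y‖ ≤ 2 * κ * ‖y‖ := by
  have hsqrt : ∀ {z : ℝ}, 0 ≤ z → z ^ 2 ≤ ‖y‖ ^ 2 * ‖ψ q‖ → z ≤ κ * ‖y‖ := by
    intro z hz h
    refine (sq_le_sq₀ hz (by positivity)).mp (h.trans ?_)
    rw [mul_pow, mul_comm]
    gcongr
  have t3 : ‖ψ (q * y)‖ ≤ κ * ‖y‖ := by
    have := cp_norm_mul_le' ψ hψ q y
    rw [hqq, hqs] at this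
    exact hsqrt (norm_nonneg _) this
  have t4 : ‖ψ ((1 - q) * y * q)‖ ≤ κ * ‖y‖ := by
    have := cp_norm_mul_le ψ hψ q ((1 - q) * y)
    rw [hqq] at this
    refine hsqrt (norm_nonneg _) (this.trans ?_)
    gcongr
    exact (norm_mul_le _ _).trans (mul_le_of_le_one_left (norm_nonneg _) hp)
  have e : ψ ((1 - q) * y * (1 - q)) - ψ y = -(ψ (q * y) + ψ ((1 - q) * y * q)) := by
    rw [← map_sub, ← map_add, ← map_neg]
    congr 1
    noncomm_ring
  rw [e, norm_neg]
  refine (norm_add_le _ _).trans ?_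
  linarith

/-- From `κ ^ 2 • ψ q ≤ ψ 1 - ψ (φ 1) ≤ 1 - ψ (φ 1)`. The fourth power is chosen because dividing by
the gap `κ ^ 2` and a later square root still leave `κ`. -/
lemma cp_norm_one_sub_map_projection_le {φ : A →CP D} {ψ : D →CP B} (hφ : ∀ x, ‖φ x‖ ≤ ‖x‖)
    (hψ : ∀ y, ‖ψ y‖ ≤ ‖y‖) {q : D} (hqq : star q * q = q) {κ : ℝ} (hκ0 : 0 < κ) (hκ1 : κ ≤ 1)
    (hqb : ((κ ^ 2 : ℝ) : ℂ) • q ≤ 1 - φ 1) (h1 : ‖ψ (φ 1) - 1‖ ≤ κ ^ 4) :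
    ‖ψ q‖ ≤ κ ^ 2 ∧ ‖ψ (1 - q) - 1‖ ≤ 2 * κ ^ 2 := by
  have hq0 : 0 ≤ q := hqq ▸ star_mul_self_nonneg q
  have hb1 : φ 1 ≤ 1 := (CStarAlgebra.norm_le_one_iff_of_nonneg _
    (cp_map_nonneg φ zero_le_one)).mp ((hφ 1).trans norm_one_le_one)
  have hψ1 : ψ 1 ≤ 1 := (CStarAlgebra.norm_le_one_iff_of_nonneg _
    (cp_map_nonneg ψ zero_le_one)).mp ((hψ 1).trans norm_one_le_one)
  rw [norm_sub_rev] at h1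
  have hn1 : ‖1 - ψ 1‖ ≤ κ ^ 4 :=
    (CStarAlgebra.norm_le_norm_of_nonneg_of_le (sub_nonneg.mpr hψ1)
      (sub_le_sub_left (OrderHomClass.mono ψ hb1) _)).trans h1
  have hnq : ‖ψ q‖ ≤ κ ^ 2 := by
    have e1 : ψ (((κ ^ 2 : ℝ) : ℂ) • q) ≤ ψ 1 - ψ (φ 1) := by
      rw [← map_sub]
      exact OrderHomClass.mono ψ hqb
    have e2 : ψ 1 - ψ (φ 1) ≤ 1 - ψ (φ 1) := sub_le_sub_right hψ1 _
    have e4 := (CStarAlgebra.norm_le_norm_of_nonneg_of_le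
      (cp_map_nonneg ψ (ofReal_smul_nonneg (sq_nonneg κ) hq0)) (e1.trans e2)).trans h1
    rw [map_smul, norm_smul, Complex.norm_real, Real.norm_of_nonneg (sq_nonneg κ)] at e4
    have e5 : 0 < κ ^ 2 := by positivity
    nlinarith
  refine ⟨hnq, ?_⟩
  have hκ4 : κ ^ 4 ≤ κ ^ 2 := pow_le_pow_of_le_one hκ0.le hκ1 (by norm_num)
  have : ψ (1 - q) - 1 = -((1 - ψ 1) + ψ q) := by rw [map_sub]; abel
  rw [this, norm_neg]
  refine (norm_add_le _ _).trans ?_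
  linarith

/-- Here `v` compresses to the corner and `w` includes it back. The unital maps are `s * v (φ x) *
s` and `S * ψ (w y) * S`, where `s`, `S` are inverse square roots of `v (φ 1)` and `ψ (1 - q)`. The
constant is `29 = 24 + 3 + 2`, from `S`, `s` and the cut-down. -/
lemma exists_unital_of_compression {φ : A →CP D} {ψ : D →CP B}
    (hφ : ∀ x, ‖φ x‖ ≤ ‖x‖) (hψ : ∀ y, ‖ψ y‖ ≤ ‖y‖) {κ : ℝ} (hκ0 : 0 < κ) (hκ1 : κ ≤ 1 / 2)
    (h1 : ‖ψ (φ 1) - 1‖ ≤ κ ^ 4) {v : D →CP D'} {w : D' →CP D} {q : D} (hv1 : v 1 = 1)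
    (hwv : ∀ x, w (v x) = (1 - q) * x * (1 - q)) (hqs : star q = q) (hqq : star q * q = q)
    (hw1 : w 1 = 1 - q) (hqb : ((κ ^ 2 : ℝ) : ℂ) • q ≤ 1 - φ 1) (hvb : ‖v (φ 1) - 1‖ ≤ κ ^ 2) :
    ∃ (φ' : A →CP D') (ψ' : D' →CP B), φ' 1 = 1 ∧ ψ' 1 = 1 ∧
      (∀ x, ‖ψ' (φ' x) - ψ (φ x)‖ ≤ 29 * κ * ‖x‖) ∧ ∀ x, ‖φ' x - v (φ x)‖ ≤ 3 * κ * ‖x‖ := by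
  have hκ2 : κ ^ 2 ≤ 1 / 4 := by nlinarith
  -- Makes the normalization errors linear: `‖s - 1‖ ≤ 2 * κ ^ 2 ≤ κ` and `‖S - 1‖ ≤ 4 * κ ^ 2 ≤ 2 *
  -- κ`.
  have hκ3 : 2 * κ ^ 2 ≤ κ := by nlinarith
  have hq0 : 0 ≤ q := hqq ▸ star_mul_self_nonneg q
  obtain ⟨hnq, hnp⟩ := cp_norm_one_sub_map_projection_le hφ hψ hqq hκ0 (by linarith) hqb h1
  obtain ⟨s, hs, hs1, hsn, hs2⟩ := exists_mul_mul_self_eq_one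
    (cp_map_isSelfAdjoint v (IsSelfAdjoint.of_nonneg (cp_map_nonneg φ zero_le_one)))
    (by linarith) hvb
  obtain ⟨S, hS, hS1, hSn, hS2⟩ := exists_mul_mul_self_eq_one
    (cp_map_isSelfAdjoint ψ ((IsSelfAdjoint.one _).sub (isSelfAdjoint_iff.mpr hqs)))
    (by linarith) hnp
  have hsκ : ‖s - 1‖ ≤ κ := hsn.trans hκ3
  have hSκ : ‖S - 1‖ ≤ 2 * κ := by linarith
  have hv : ∀ x, ‖v x‖ ≤ ‖x‖ := cp_norm_le v (hv1 ▸ norm_one_le_one)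
  have hp : ‖1 - q‖ ≤ 1 := by
    rw [← hw1]
    refine (CStarAlgebra.norm_le_one_iff_of_nonneg _ (cp_map_nonneg w zero_le_one)).mpr ?_
    rw [hw1]
    exact sub_le_self _ hq0
  have hw : ∀ x, ‖w x‖ ≤ ‖x‖ := cp_norm_le w (hw1 ▸ hp)
  have hφ' : ∀ x, cpComp (cpConj s) (cpComp v φ) x = s * v (φ x) * s :=
    fun x => by rw [cpComp_apply, cpComp_apply, cpConj_apply, hs.star_eq]
  have hψ' : ∀ y, cpComp (cpConj S) (cpComp ψ w) y = S * ψ (w y) * S :=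
    fun y => by rw [cpComp_apply, cpComp_apply, cpConj_apply, hS.star_eq]
  have hnear : ∀ x, ‖s * v (φ x) * s - v (φ x)‖ ≤ 3 * κ * ‖x‖ := fun x =>
    (norm_mul_mul_self_sub_le hsκ hs2).trans
      (mul_le_mul_of_nonneg_left ((hv _).trans (hφ x)) (by positivity))
  refine ⟨cpComp (cpConj s) (cpComp v φ), cpComp (cpConj S) (cpComp ψ w), ?_, ?_, fun x => ?_,
    fun x => ?_⟩
  · rw [hφ', hs1]
  · rw [hψ', hw1, hS1]
  · rw [hφ', hψ']
    set y := s * v (φ x) * s with hy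
    have hyn : ‖y‖ ≤ 4 * ‖x‖ := by
      calc ‖y‖ ≤ ‖s‖ * ‖v (φ x)‖ * ‖s‖ :=
            (norm_mul_le _ _).trans (mul_le_mul_of_nonneg_right (norm_mul_le _ _) (norm_nonneg _))
        _ ≤ 2 * ‖x‖ * 2 := by
            gcongr
            exact (hv _).trans (hφ x)
        _ = 4 * ‖x‖ := by ring
    have t1 : ‖S * ψ (w y) * S - ψ (w y)‖ ≤ 24 * κ * ‖x‖ := by
      refine (norm_mul_mul_self_sub_le hSκ hS2).trans ?_
      calc 3 * (2 * κ) * ‖ψ (w y)‖ ≤ 3 * (2 * κ) * (4 * ‖x‖) := by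
            gcongr
            exact (hψ _).trans ((hw _).trans hyn)
        _ = _ := by ring
    have t2 : ‖ψ (w y) - ψ ((1 - q) * φ x * (1 - q))‖ ≤ 3 * κ * ‖x‖ := by
      rw [← hwv, ← map_sub, ← map_sub]
      exact (hψ _).trans ((hw _).trans (hnear x))
    have t3 : ‖ψ ((1 - q) * φ x * (1 - q)) - ψ (φ x)‖ ≤ 2 * κ * ‖x‖ :=
      (cp_norm_compression_sub_le hψ hqs hqq hp hκ0.le hnq _).trans
        (mul_le_mul_of_nonneg_left (hφ x) (by positivity))
    have e1 := norm_sub_le_norm_sub_add_norm_sub (S * ψ (w y) * S) (ψ (w y)) (ψ (φ x))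
    have e2 := norm_sub_le_norm_sub_add_norm_sub (ψ (w y)) (ψ ((1 - q) * φ x * (1 - q)))
      (ψ (φ x))
    linarith
  · rw [hφ']
    exact hnear x

/-- Contractive completely positive maps `φ`, `ψ` through a finite-dimensional algebra such that
`ψ (φ 1)` is close to `1` can be replaced by unital ones. -/
lemma exists_unital_factorization {k : ℕ} {d : Fin k → ℕ} (φ : A →CP FinDimAlg d)
    (ψ : FinDimAlg d →CP B)
    (hφ : ∀ x, ‖φ x‖ ≤ ‖x‖) (hψ : ∀ y, ‖ψ y‖ ≤ ‖y‖) {κ : ℝ} (hκ0 : 0 < κ) (hκ1 : κ ≤ 1 / 2)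
    (h1 : ‖ψ (φ 1) - 1‖ ≤ κ ^ 4) :
    ∃ (d' : Fin k → ℕ) (φ' : A →CP FinDimAlg d') (ψ' : FinDimAlg d' →CP B),
      φ' 1 = 1 ∧ ψ' 1 = 1 ∧ (∀ x, ‖ψ' (φ' x) - ψ (φ x)‖ ≤ 29 * κ * ‖x‖) ∧
      ∀ x, IsSelfAdjoint x → (FinDimAlg.tr (NormedSpace.exp (φ' x))).re ≤
        Real.exp (3 * κ * ‖x‖) * (FinDimAlg.tr (NormedSpace.exp (φ x))).re := by
  have hb0 : 0 ≤ φ 1 := cp_map_nonneg φ zero_le_one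
  have hb1 : φ 1 ≤ 1 :=
    (CStarAlgebra.norm_le_one_iff_of_nonneg _ hb0).mp ((hφ 1).trans norm_one_le_one)
  obtain ⟨d', V, q, hV, hV1, hVpp, hqs, hqq, hVq, hqb, hc⟩ :=
    exists_block_compression hb0 hb1 (sq_nonneg κ)
  obtain ⟨φ', ψ', h2, h3, h4, h5⟩ :=
    exists_unital_of_compression hφ hψ hκ0 hκ1 h1 hV1 hVpp hqs hqq hVq hqb hc
  exact ⟨d', φ', ψ', h2, h3, h4, fun x hx => FinDimAlg.tr_re_exp_le
    (cp_map_isSelfAdjoint φ hx) (cp_map_isSelfAdjoint φ' hx) hV (h5 x)⟩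

end Unitalization

/-! ### Norm bounds along the orbit -/

section Iterates

variable {A : Type*} [CStarAlgebra A] [PartialOrder A] [StarOrderedRing A] {θ : A →CP A}

lemma norm_iterate_le (hθ : θ 1 = 1) (j : ℕ) (x : A) : ‖θ^[j] x‖ ≤ ‖x‖ := by
  induction j with
  | zero => rfl
  | succ j ih =>
    rw [Function.iterate_succ_apply']
    exact (cp_norm_le θ (by rw [hθ]; exact norm_one_le_one) _).trans ih

lemma isSelfAdjoint_orbitSum {a : A} (ha : IsSelfAdjoint a) (n : ℕ) :
    IsSelfAdjoint (orbitSum θ a n) := by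
  suffices h : ∀ j, IsSelfAdjoint (θ^[j] a) from isSelfAdjoint_sum _ fun j _ => h j
  intro j
  induction j with
  | zero => exact ha
  | succ j ih =>
    rw [Function.iterate_succ_apply']
    exact cp_map_isSelfAdjoint θ ih

lemma norm_orbitSum_le (hθ : θ 1 = 1) (a : A) (n : ℕ) : ‖orbitSum θ a n‖ ≤ n * ‖a‖ := by
  refine (norm_sum_le_of_le _ fun j _ => norm_iterate_le hθ j a).trans ?_
  simp

lemma norm_le_of_mem_orbitSet (hθ : θ 1 = 1) {Ω : Finset A} {n : ℕ} {x : A}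
    (hx : x ∈ orbitSet θ Ω n) : ‖x‖ ≤ ∑ w ∈ Ω, ‖w‖ := by
  obtain ⟨j, _, w, hw, rfl⟩ := hx
  exact (norm_iterate_le hθ j w).trans
    (Finset.single_le_sum (f := fun w => ‖w‖) (fun _ _ => norm_nonneg _) hw)

end Iterates

/-! ### Comparing partition functions and pressures -/

section Comparison

variable {A : Type*} [CStarAlgebra A] [PartialOrder A] [StarOrderedRing A] {θ : A →CP A}
  {H : Type*} [NormedAddCommGroup H] [InnerProductSpace ℂ H] [CompleteSpace H]
  {π : A →⋆ₐ[ℂ] (H →L[ℂ] H)}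

lemma IsCPA.isCPA₀ {S : Set A} {δ : ℝ} {k : ℕ} {d : Fin k → ℕ} {φ : A →CP FinDimAlg d}
    {ψ : FinDimAlg d →CP (H →L[ℂ] H)} (h : IsCPA π S δ φ ψ) :
    IsCPA₀ (π : A →⋆ₙₐ[ℂ] (H →L[ℂ] H)) S δ φ ψ where
  norm_left_le := cp_norm_le φ (h.map_one_left ▸ norm_one_le_one)
  norm_right_le := cp_norm_le ψ (h.map_one_right ▸ norm_one_le_one)
  approx := h.approx

lemma partition₀_le_partition (a : A) (Ω : Finset A) (δ : ℝ) (n : ℕ) :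
    partition₀ θ (π : A →⋆ₙₐ[ℂ] (H →L[ℂ] H)) a Ω δ n ≤ partition θ π a Ω δ n := by
  refine sInf_le_sInf ?_
  rintro r ⟨k, d, φ, ψ, h, hr⟩
  exact ⟨k, d, φ, ψ, h.isCPA₀, hr⟩

lemma pressure₀_le_pressure (θ : A →CP A) (π : A →⋆ₐ[ℂ] (H →L[ℂ] H)) (a : A) :
    pressure₀ θ (π : A →⋆ₙₐ[ℂ] (H →L[ℂ] H)) a ≤ pressure θ π a := by
  refine iSup_mono fun Ω => iSup_mono fun δ => iSup_mono fun _ => ?_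
  refine Filter.limsup_le_limsup (Filter.Eventually.of_forall fun n => ?_)
  exact EReal.div_le_div_right_of_nonneg (Nat.cast_nonneg' n)
    (ENNReal.log_le_log (partition₀_le_partition a Ω δ n))

-- Inserting `1` into `Ω` puts `1` in the orbit set (at `j = 0`, hence `0 < n`), which forces `ψ (φ
-- 1)` to be near `1`.
open Classical in
lemma partition_le_mul_partition₀ (hθ : θ 1 = 1) {a : A} (ha : IsSelfAdjoint a) {Ω : Finset A}
    {δ δ' κ : ℝ} (hκ0 : 0 < κ) (hκ1 : κ ≤ 1 / 2) (h1 : δ' ≤ κ ^ 4)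
    (h2 : 29 * κ * ∑ w ∈ Ω, ‖w‖ + δ' ≤ δ) {n : ℕ} (hn : 0 < n) :
    partition θ π a Ω δ n ≤ ENNReal.ofReal (Real.exp (3 * κ * (n * ‖a‖))) *
      partition₀ θ (π : A →⋆ₙₐ[ℂ] (H →L[ℂ] H)) a (insert 1 Ω) δ' n := by
  rw [← ENNReal.div_le_iff' (by positivity) ENNReal.ofReal_ne_top]
  refine le_sInf ?_
  rintro r ⟨k, d, φ, ψ, h, rfl⟩
  have hone : ‖ψ (φ 1) - 1‖ ≤ κ ^ 4 := by
    have := h.approx 1 ⟨0, hn, 1, Finset.mem_insert_self _ _, rfl⟩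
    change ‖ψ (φ 1) - π 1‖ < δ' at this
    rw [map_one π] at this
    exact this.le.trans h1
  obtain ⟨d', φ', ψ', hφ', hψ', happ, htr⟩ :=
    exists_unital_factorization φ ψ h.norm_left_le h.norm_right_le hκ0 hκ1 hone
  have hcpa : IsCPA π (orbitSet θ Ω n) δ φ' ψ' := by
    refine ⟨hφ', hψ', fun x hx => ?_⟩
    have e1 : ‖ψ (φ x) - π x‖ < δ' := by
      obtain ⟨j, hj, w, hw, hx⟩ := hx
      exact h.approx x ⟨j, hj, w, Finset.mem_insert_of_mem hw, hx⟩
    have e2 : 29 * κ * ‖x‖ ≤ 29 * κ * ∑ w ∈ Ω, ‖w‖ :=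
      mul_le_mul_of_nonneg_left (norm_le_of_mem_orbitSet hθ hx) (by positivity)
    have e3 := norm_sub_le_norm_sub_add_norm_sub (ψ' (φ' x)) (ψ (φ x)) (π x)
    have e4 := happ x
    linarith
  rw [ENNReal.div_le_iff' (by positivity) ENNReal.ofReal_ne_top]
  have hle : partition θ π a Ω δ n ≤
      ENNReal.ofReal (FinDimAlg.tr (NormedSpace.exp (φ' (orbitSum θ a n)))).re :=
    sInf_le ⟨k, d', φ', ψ', hcpa, rfl⟩
  refine hle.trans ?_
  rw [← ENNReal.ofReal_mul (Real.exp_nonneg _)]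
  -- `ENNReal.ofReal` truncates at `0`; splitting on the sign avoids proving that the trace is
  -- nonnegative.
  by_cases htr0 : 0 ≤ (FinDimAlg.tr (NormedSpace.exp (φ (orbitSum θ a n)))).re
  · refine ENNReal.ofReal_le_ofReal ((htr _ (isSelfAdjoint_orbitSum ha n)).trans ?_)
    gcongr
    exact norm_orbitSum_le hθ a n
  · rw [ENNReal.ofReal_of_nonpos]
    · exact zero_le
    · exact (htr _ (isSelfAdjoint_orbitSum ha n)).trans
        (mul_nonpos_of_nonneg_of_nonpos (Real.exp_nonneg _) (not_le.mp htr0).le)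

lemma pressure_le_pressure₀ (hθ : θ 1 = 1) {a : A} (ha : IsSelfAdjoint a) :
    pressure θ π a ≤ pressure₀ θ (π : A →⋆ₙₐ[ℂ] (H →L[ℂ] H)) a := by
  classical
  refine iSup_le fun Ω => iSup_le fun δ => iSup_le fun hδ => ?_
  rw [← EReal.le_of_forall_lt_iff_le]
  intro z hz
  -- The gap `z - z'` is the room for the exponential error `3 * κ * ‖a‖`; real bounds also cover
  -- infinite pressures.
  obtain ⟨z', hz1, hz2⟩ := EReal.lt_iff_exists_real_btwn.mp hz
  have hzz : 0 < z - z' := sub_pos.mpr (by exact_mod_cast hz2)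
  set M := ∑ w ∈ Ω, ‖w‖ with hM
  have hM0 : 0 ≤ M := Finset.sum_nonneg fun _ _ => norm_nonneg _
  have ha0 : 0 ≤ ‖a‖ := norm_nonneg a
  obtain ⟨κ, hκ0, hκ1, hκ2, hκ3⟩ : ∃ κ : ℝ, 0 < κ ∧ κ ≤ 1 / 2 ∧ 29 * κ * M ≤ δ / 2 ∧
      3 * κ * ‖a‖ ≤ z - z' := by
    -- `58 = 2 * 29` leaves half of `δ` for `δ'`; the `+ 1`s keep the denominators positive when `M`
    -- or `‖a‖` vanishes.
    refine ⟨min (1 / 2) (min (δ / (58 * (M + 1))) ((z - z') / (3 * (‖a‖ + 1)))), by positivity,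
      min_le_left _ _, ?_, ?_⟩
    · have h := (min_le_right (1 / 2) (min (δ / (58 * (M + 1))) ((z - z') / (3 * (‖a‖ + 1))))).trans
        (min_le_left _ _)
      have h0 : 0 ≤ min (1 / 2) (min (δ / (58 * (M + 1))) ((z - z') / (3 * (‖a‖ + 1)))) := by
        positivity
      rw [le_div_iff₀ (by positivity)] at h
      linarith
    · have h := (min_le_right (1 / 2) (min (δ / (58 * (M + 1))) ((z - z') / (3 * (‖a‖ + 1))))).trans
        (min_le_right _ _)
      have h0 : 0 ≤ min (1 / 2) (min (δ / (58 * (M + 1))) ((z - z') / (3 * (‖a‖ + 1)))) := by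
        positivity
      rw [le_div_iff₀ (by positivity)] at h
      linarith
  set δ' := min (δ / 2) (κ ^ 4) with hδ'
  have hδ'0 : 0 < δ' := by positivity
  have hlim : Filter.limsup (fun n : ℕ => ENNReal.log (partition₀ θ
      (π : A →⋆ₙₐ[ℂ] (H →L[ℂ] H)) a (insert 1 Ω) δ' n) / (n : EReal)) Filter.atTop < z' :=
    lt_of_le_of_lt (le_iSup_of_le (insert 1 Ω) (le_iSup_of_le δ'
      (le_iSup_of_le (f := fun _ : 0 < δ' => _) hδ'0 le_rfl))) hz1
  refine Filter.limsup_le_of_le (h := ?_)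
  filter_upwards [Filter.eventually_lt_of_limsup_lt hlim, Filter.eventually_gt_atTop 0]
    with n h1 hn
  have hn' : (0 : ℝ) < n := Nat.cast_pos.mpr hn
  have h2 := partition_le_mul_partition₀ (π := π) hθ ha (Ω := Ω) (δ := δ) hκ0 hκ1
    (min_le_right (δ / 2) (κ ^ 4)) (by linarith [min_le_left (δ / 2) (κ ^ 4)]) hn
  have h3 := EReal.div_le_div_right_of_nonneg (Nat.cast_nonneg' (α := EReal) n)
    (ENNReal.log_le_log h2)
  rw [ENNReal.log_mul_add, ENNReal.log_ofReal_of_pos (Real.exp_pos _), Real.log_exp,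
    EReal.add_div_of_nonneg_right (Nat.cast_nonneg' n)] at h3
  have h4 : ((3 * κ * (n * ‖a‖) : ℝ) : EReal) / (n : EReal) = ((3 * κ * ‖a‖ : ℝ) : EReal) := by
    rw [← EReal.coe_coe_eq_natCast, ← EReal.coe_div]
    congr 1
    field_simp
  rw [h4] at h3
  refine h3.trans ((add_le_add_right h1.le _).trans ?_)
  rw [← EReal.coe_add, EReal.coe_le_coe_iff]
  linarith

end Comparison

end NCPressure

end

theorem proposition2p3 {A : Type*} [CStarAlgebra A] [PartialOrder A] [StarOrderedRing A]
    (hA : NCPressure.IsExact A)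
    (θ : A →CP A) (hθ : θ 1 = 1) (a : A) (ha : IsSelfAdjoint a)
    {H : Type*} [NormedAddCommGroup H] [InnerProductSpace ℂ H] [CompleteSpace H]
    (π : A →⋆ₐ[ℂ] (H →L[ℂ] H)) (hπ : Function.Injective π) :
    NCPressure.pressure₀ θ (π : A →⋆ₙₐ[ℂ] (H →L[ℂ] H)) a = NCPressure.pressure θ π a :=
  le_antisymm (NCPressure.pressure₀_le_pressure θ π a)
    (NCPressure.pressure_le_pressure₀ hθ ha)
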